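/- Let $q$ be a power of $2$, let $m\ge 0$ be an integer and let $\varepsilon\in\{1,-1\}$. A non-degenerate quadratic form is said to have type $+1$ (hyperbolic), $0$ (parabolic) or $-1$ (elliptic) if its Witt index $w$ (the largest dimension of a totally singular subspace) is such that the underlying vector space has dimension $2w$, $2w+1$ or $2w+2$, respectively. Here a quadratic form in even dimension is non-degenerate if its polar form is non-degenerate, and in odd dimension if the radical of its polar form is one-dimensional and the form does not vanish at the non-zero vectors of this radical; otherwise the form is degenerate. Let $P$ be any quadratic form of type $0$ on $\mathbb{F}_q^{2m+1}$; it defines the parabolic quadric $Q(2m,q)$ in $PG(2m,q)$, whose nucleus is the point given by the radical of the polar form of $P$. The graph $NO^{\varepsilon}(2m+1,q)$ has as vertices the hyperplanes $H$ of $PG(2m,q)$ that do not contain the nucleus and for which the restriction of $P$ to $H$ is non-degenerate of type $\varepsilon$; two distinct vertices $H_1,H_2$ are adjacent if and only if the restriction of $P$ to $H_1\cap H_2$ is degenerate. Let $\Theta$ be a non-degenerate quadratic form on $\mathbb{F}_q^{2m}$ of type $-\varepsilon$, and let $\langle a,b\rangle=\Theta(a+b)+\Theta(a)+\Theta(b)$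 be the associated symplectic form. Define the graph $(V,E)$ by $$V=\{a\in\mathbb{F}_q^{2m} : \mathrm{Tr}_{\mathbb{F}_q/\mathbb{F}_2}(\Theta(a))=1\},\qquad E=\{(a,b)\in V\times V : a\ne b \text{ and } \Theta(a+b)=\langle a,b\rangle^2\}.$$ Then $(V,E)$ is isomorphic to $NO^{\varepsilon}(2m+1,q)$. -/

import Mathlib

namespace PolarGraph

section Forms

variable {F V : Type*} [Field F] [AddCommGroup V] [Module F V]

/-- The Witt index of a quadratic form on a finite-dimensional space: the largest dimension of a
totally singular subspace. -/
noncomputable def wittIndex (Q : QuadraticForm F V) : ℕ :=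
  sSup {k : ℕ | ∃ W : Submodule F V, (∀ x ∈ W, Q x = 0) ∧ Module.finrank F W = k}

/-- A non-degenerate quadratic form of Witt index `w` has type `1` (hyperbolic), `0` (parabolic) or
`-1` (elliptic) if the dimension of the space is `2w`, `2w + 1` or `2w + 2`, respectively.

Non-degeneracy is Mathlib's `QuadraticMap.Nondegenerate` (the radical of the form is zero and the
radical of its polar form has dimension at most one). In characteristic two the polar form is
alternating, so this says that the polar form is non-degenerate if the dimension is even, and that
its radical is a line on which the quadratic form does not vanish if the dimension is odd. -/
def HasType (Q : QuadraticForm F V) (ε : ℤ) : Prop :=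
  Q.Nondegenerate ∧ (Module.finrank F V : ℤ) = 2 * wittIndex Q + 1 - ε

/-- The radical of the polar form of `P`. For a parabolic form in characteristic two this is the
one-dimensional subspace which is the nucleus of the quadric `P = 0`. -/
def nucleus (P : QuadraticForm F V) : Submodule F V := LinearMap.ker P.polarBilin

/-- The hyperplanes (subspaces of codimension one) which do not contain the nucleus of `P` and meet
the quadric `P = 0` in a non-singular quadric of type `ε`. -/
def IsVertexNO (P : QuadraticForm F V) (ε : ℤ) (H : Submodule F V) : Prop :=
  IsCoatom H ∧ ¬ nucleus P ≤ H ∧ HasType (P.restrict H) ε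

/-- The graph `NO^ε(2m+1,q)` of the parabolic quadric `P = 0` in `PG(2m,q)`: two distinct
hyperplanes are adjacent if their intersection meets the quadric in a degenerate quadric. -/
def graphNO (P : QuadraticForm F V) (ε : ℤ) : SimpleGraph {H : Submodule F V // IsVertexNO P ε H} where
  Adj H₁ H₂ := H₁ ≠ H₂ ∧ ¬ (P.restrict (H₁.1 ⊓ H₂.1)).Nondegenerate
  symm := ⟨fun H₁ H₂ h => ⟨h.1.symm, by rw [inf_comm]; exact h.2⟩⟩
  loopless := ⟨fun _ h => h.1 rfl⟩

/-- The graph on the vectors `a` with `Tr (Θ a) = 1`, where `a ≠ b` are adjacent if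
`Θ (a + b) = ⟨a, b⟩ ^ 2`; here `⟨a, b⟩ = Θ (a + b) - Θ a - Θ b` is the polar form of `Θ`, and `Tr`
is the trace to the prime field of order two. -/
def analyticGraph [Algebra (ZMod 2) F] (Θ : QuadraticForm F V) :
    SimpleGraph {a : V // Algebra.trace (ZMod 2) F (Θ a) = 1} where
  Adj a b := a ≠ b ∧ Θ (a.1 + b.1) = (QuadraticMap.polar Θ a.1 b.1) ^ 2
  symm := ⟨fun a b h => ⟨h.1.symm, by rw [add_comm, QuadraticMap.polar_comm]; exact h.2⟩⟩
  loopless := ⟨fun _ h => h.1 rfl⟩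

end Forms

end PolarGraph

/-! In suitable coordinates `(x, t)` the parabolic form is `Θ x + t ^ 2`, with nucleus spanned by
`(0, 1)` (`exists_parabolic_coordinates`). A hyperplane missing the nucleus is then the graph `t =
⟨a, x⟩` for exactly one vector `a`, and on it the form becomes `Θ_a x = Θ x + ⟨a, x⟩ ^ 2`, the
`twist`, whose polar form is that of `Θ`.

The vertex condition is an exponential sum computation. For the character `χ t = (-1) ^ Tr t`, the
sum of `χ ∘ Q` over a space of dimension `2m` is `± q ^ m`, and the sign is the type
(`hasType_iff_formSum`). Since `Tr (s ^ 2) = Tr s`, translating by `a` shows that the sum for `Θ_a`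
is `χ (Θ a)` times that for `Θ` (`formSum_twist`), so the type flips exactly when `Tr (Θ a) = 1`.

For adjacency, the hyperplanes of `a ≠ b` meet over `c^⊥`, where `c = a + b`. There the polar form
has radical spanned by `c`, so degeneracy means `Θ_a c = 0`, which is `Θ (a + b) = ⟨a, b⟩ ^ 2`
(`nondegenerate_restrict_inf_iff`). -/

namespace PolarGraph

open Module

/-! ### Classification of alternating forms without radical -/

section Alternating

universe u v

variable {F : Type*} [Field F]

/-- A non-zero alternating form without radical splits off a hyperbolic plane. -/
theorem exists_hyperbolic_splitting {V : Type u} [AddCommGroup V] [Module F V]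
    (B : LinearMap.BilinForm F V) (hB : B.IsAlt) (hs : B.SeparatingLeft) [Nontrivial V] :
    ∃ (W : Submodule F V) (e : V ≃ₗ[F] (F × F) × W), (B.restrict W).IsAlt ∧
      (B.restrict W).SeparatingLeft ∧ ∀ x y, B x y =
        (e x).1.1 * (e y).1.2 - (e x).1.2 * (e y).1.1 + B.restrict W (e x).2 (e y).2 := by
  obtain ⟨p, hp⟩ := exists_ne (0 : V)
  obtain ⟨r, hr⟩ : ∃ r, B p r = 1 := by
    have : ∃ r, B p r ≠ 0 := by
      by_contra! h
      exact hp (hs p h)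
    obtain ⟨r, hr⟩ := this
    exact ⟨(B p r)⁻¹ • r, by simp [hr]⟩
  have hsw : ∀ x y, B x y = -B y x := fun x y => by
    rw [LinearMap.BilinForm.IsAlt.neg_eq hB]
  have hrp : B r p = -1 := by rw [hsw, hr]
  let W : Submodule F V := LinearMap.ker (B p) ⊓ LinearMap.ker (B r)
  have hW : ∀ w : W, B p w = 0 ∧ B r w = 0 := fun w => w.2
  have hW' : ∀ w : W, B w p = 0 ∧ B w r = 0 := fun w => by
    rw [hsw _ p, hsw _ r, (hW w).1, (hW w).2]; simp
  let e : V ≃ₗ[F] (F × F) × W :=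
    { toFun := fun x => ((-B r x, B p x),
        ⟨x + B r x • p - B p x • r, by
          constructor <;> simp [hr, hrp, hB.self_eq_zero]⟩)
      map_add' := fun x y => by
        ext <;> simp
        · ring
        · module
      map_smul' := fun c x => by
        ext <;> simp
        module
      invFun := fun z => z.1.1 • p + z.1.2 • r + z.2
      left_inv := fun x => by
        simp only
        module
      right_inv := fun ⟨⟨s, t⟩, w⟩ => by
        have h1 := hW w
        ext <;> simp [hr, hrp, hB.self_eq_zero, h1.1, h1.2]
        module }
  have hes : ∀ z, e.symm z = z.1.1 • p + z.1.2 • r + z.2 := fun z => rfl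
  have hsymm : ∀ z z', B (e.symm z) (e.symm z') =
      z.1.1 * z'.1.2 - z.1.2 * z'.1.1 + B.restrict W z.2 z'.2 := by
    intro z z'
    simp [hes, hr, hrp, hB.self_eq_zero, (hW _).1, (hW _).2, (hW' _).1, (hW' _).2]
    ring
  have hform : ∀ x y, B x y =
      (e x).1.1 * (e y).1.2 - (e x).1.2 * (e y).1.1 + B.restrict W (e x).2 (e y).2 :=
    fun x y => by simpa only [LinearEquiv.symm_apply_apply] using hsymm (e x) (e y)
  refine ⟨W, e, fun w => hB _, fun w hw => ?_, hform⟩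
  have : e.symm (0, w) = 0 := hs _ fun y => by
    rw [hform]
    simpa using hw (e y).2
  simpa using this

theorem finrank_splitting {V : Type u} [AddCommGroup V] [Module F V] [FiniteDimensional F V]
    {W : Submodule F V} (e : V ≃ₗ[F] (F × F) × W) : finrank F V = finrank F W + 2 := by
  rw [e.finrank_eq]
  simp [add_comm]

/-- The dimension of a space with an alternating form without radical is even. -/
theorem even_finrank_of_isAlt {V : Type u} [AddCommGroup V] [Module F V] [FiniteDimensional F V]
    (B : LinearMap.BilinForm F V) (hB : B.IsAlt) (hs : B.SeparatingLeft) :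
    Even (finrank F V) := by
  induction hn : finrank F V using Nat.strong_induction_on generalizing V with
  | _ n ih =>
    subst hn
    rcases subsingleton_or_nontrivial V with h | h
    · simp [finrank_zero_of_subsingleton]
    · obtain ⟨W, e, h1, h2, -⟩ := exists_hyperbolic_splitting B hB hs
      have := finrank_splitting e
      have h3 := ih _ (by omega) _ h1 h2 rfl
      rw [this]
      exact h3.add even_two

/-- Alternating forms without radical on spaces of the same dimension are isometric. -/
theorem exists_isometry_of_isAlt {V : Type u} {V' : Type v} [AddCommGroup V] [Module F V]
    [FiniteDimensional F V] [AddCommGroup V'] [Module F V'] [FiniteDimensional F V']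
    (B : LinearMap.BilinForm F V) (hB : B.IsAlt) (hs : B.SeparatingLeft)
    (B' : LinearMap.BilinForm F V') (hB' : B'.IsAlt) (hs' : B'.SeparatingLeft)
    (h : finrank F V = finrank F V') :
    ∃ e : V ≃ₗ[F] V', ∀ x y, B' (e x) (e y) = B x y := by
  induction hn : finrank F V using Nat.strong_induction_on generalizing V V' with
  | _ n ih =>
    subst hn
    rcases subsingleton_or_nontrivial V with h0 | h0
    · refine ⟨LinearEquiv.ofFinrankEq V V' h, fun x y => ?_⟩
      rw [Subsingleton.elim x 0]
      simp
    · have : Nontrivial V' := by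
        rw [← finrank_pos_iff (R := F), ← h]
        exact finrank_pos
      obtain ⟨W, e, h1, h2, h3⟩ := exists_hyperbolic_splitting B hB hs
      obtain ⟨W', e', h1', h2', h3'⟩ := exists_hyperbolic_splitting B' hB' hs'
      have hd := finrank_splitting e
      have hd' := finrank_splitting e'
      obtain ⟨g, hg⟩ := ih _ (by omega) _ h1 h2 _ h1' h2' (by omega) rfl
      refine ⟨e ≪≫ₗ (LinearEquiv.prodCongr (LinearEquiv.refl F _) g) ≪≫ₗ e'.symm, fun x y => ?_⟩
      rw [h3, h3']
      simp only [LinearEquiv.trans_apply, LinearEquiv.apply_symm_apply,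
        LinearEquiv.prodCongr_apply, LinearEquiv.refl_apply, hg]

end Alternating

/-! ### Non-degeneracy in characteristic two -/

section CharTwo

variable {F V : Type*} [Field F] [AddCommGroup V] [Module F V]

theorem isAlt_polarBilin [CharP F 2] (Q : QuadraticForm F V) : Q.polarBilin.IsAlt := fun x => by
  rw [QuadraticMap.polarBilin_apply_apply, QuadraticMap.polar_self, two_nsmul, CharTwo.add_self_eq_zero]

/-- The polar form has no radical on a complement of its radical. -/
theorem separatingLeft_polarBilin_restrict (Q : QuadraticForm F V) {K : Submodule F V}
    (hK : IsCompl (LinearMap.ker Q.polarBilin) K) :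
    (Q.restrict K).polarBilin.SeparatingLeft := by
  intro x hx
  have hx0 : (x : V) ∈ LinearMap.ker Q.polarBilin := by
    rw [LinearMap.mem_ker]
    ext y
    obtain ⟨k, hk, z, hz, rfl⟩ := Submodule.mem_sup.1 (hK.sup_eq_top ▸ Submodule.mem_top : y ∈ _)
    have h1 : QuadraticMap.polar Q x k = 0 := by
      rw [QuadraticMap.polar_comm]
      exact DFunLike.congr_fun (LinearMap.mem_ker.1 hk) (x : V)
    have h2 : QuadraticMap.polar Q x z = 0 := hx ⟨z, hz⟩
    simp [QuadraticMap.polar_add_right, h1, h2]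
  exact Subtype.ext (Submodule.disjoint_def.1 hK.disjoint _ hx0 x.2)

theorem finrank_ker_polarBilin_le {Q : QuadraticForm F V} (h : Q.Nondegenerate) :
    finrank F (LinearMap.ker Q.polarBilin) ≤ 1 :=
  finrank_le_of_rank_le (by simpa using h.rank_rad_polar_le)

variable [CharP F 2] [FiniteDimensional F V]

theorem even_finrank_sub_ker (Q : QuadraticForm F V) {K : Submodule F V}
    (hK : IsCompl (LinearMap.ker Q.polarBilin) K) : Even (finrank F K) :=
  even_finrank_of_isAlt _ (isAlt_polarBilin (Q.restrict K))
    (separatingLeft_polarBilin_restrict Q hK)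

/-- In even dimension a quadratic form is non-degenerate iff its polar form is. -/
theorem nondegenerate_iff_separatingLeft (Q : QuadraticForm F V) (h : Even (finrank F V)) :
    Q.Nondegenerate ↔ Q.polarBilin.SeparatingLeft := by
  rw [LinearMap.separatingLeft_iff_ker_eq_bot]
  refine ⟨fun hQ => ?_, fun hQ => ⟨?_, by rw [hQ]; simp⟩⟩
  · obtain ⟨K, hK⟩ := Submodule.exists_isCompl (LinearMap.ker Q.polarBilin)
    have h1 := even_finrank_sub_ker Q hK
    have h2 := finrank_ker_polarBilin_le hQ
    have h3 := Submodule.finrank_add_eq_of_isCompl hK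
    rw [← h3, Nat.even_add] at h
    -- The radical has even dimension, at most one, hence zero.
    have h4 := h.2 h1
    rw [← Submodule.finrank_eq_zero (R := F)]
    rcases h4 with ⟨r, hr⟩
    omega
  · rw [eq_bot_iff, ← hQ]
    exact QuadraticMap.radical_le_ker_polarBilin

end CharTwo

/-! ### Exponential sums of quadratic forms -/

section FormSum

variable {F V : Type*} [Field F] [AddCommGroup V] [Module F V]

/-- The exponential sum of a quadratic form with respect to a real additive character. -/
noncomputable def formSum (χ : AddChar F ℤ) (Q : QuadraticForm F V) : ℤ := ∑ᶠ x, χ (Q x)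

theorem formSum_congr {V' : Type*} [AddCommGroup V'] [Module F V'] (χ : AddChar F ℤ)
    {Q : QuadraticForm F V} {Q' : QuadraticForm F V'} (e : V ≃ V') (h : ∀ x, Q' (e x) = Q x) :
    formSum χ Q = formSum χ Q' := by
  rw [formSum, formSum, ← finsum_comp_equiv e]
  simp [h]

variable [Finite F] [Finite V]

/-- Evaluate the sum of `χ (Q (c • x))` over all `c` and `x` in both orders: each `c ≠ 0` merely
permutes the vectors, while for fixed `x` the squares `c * c` run once through the field, so only
singular `x` contribute. -/
theorem card_sub_one_mul_formSum [CharP F 2] {χ : AddChar F ℤ} (hχ : χ ≠ 1)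
    (Q : QuadraticForm F V) :
    ((Nat.card F : ℤ) - 1) * formSum χ Q = Nat.card F * Nat.card {x // Q x = 0} - Nat.card V := by
  classical
  have := Fintype.ofFinite F
  have := Fintype.ofFinite V
  rw [formSum, finsum_eq_sum_of_fintype]
  simp only [Nat.card_eq_fintype_card]
  have h1 : ∑ c : F, ∑ x : V, χ (Q (c • x)) =
      Fintype.card V + ((Fintype.card F : ℤ) - 1) * ∑ x, χ (Q x) := by
    rw [← Finset.add_sum_erase _ _ (Finset.mem_univ (0 : F))]
    congr 1
    · simp
    · rw [Finset.sum_congr rfl (g := fun _ => ∑ x, χ (Q x))]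
      · rw [Finset.sum_const, Finset.card_erase_of_mem (Finset.mem_univ _), Finset.card_univ,
          nsmul_eq_mul, Nat.cast_sub Fintype.card_pos, Nat.cast_one]
      · intro c hc
        exact Fintype.sum_bijective (fun x : V => c • x)
          (MulAction.bijective₀ (Finset.ne_of_mem_erase hc)) _ _ fun x => rfl
  have h2 : ∑ c : F, ∑ x : V, χ (Q (c • x)) = Fintype.card F * Fintype.card {x // Q x = 0} := by
    rw [Finset.sum_comm]
    have h3 : ∀ x : V, ∑ c : F, χ (Q (c • x)) = if Q x = 0 then (Fintype.card F : ℤ) else 0 := by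
      intro x
      have h4 := AddChar.sum_mulShift (Q x) (AddChar.IsPrimitive.of_ne_one hχ)
      push_cast at h4
      rw [← h4]
      refine Fintype.sum_bijective (fun c : F => c * c) ?_ _ _ fun c => ?_
      · rw [← Finite.injective_iff_bijective]
        intro a b hab
        simp only [← sq] at hab
        exact CharTwo.sq_injective hab
      · rw [QuadraticMap.map_smul, smul_eq_mul]
    simp only [h3]
    rw [← Finset.sum_filter, Finset.sum_const, Fintype.card_subtype, nsmul_eq_mul, mul_comm]
  linarith

/-- Averaging over translations by `U` leaves the full sum unchanged, and by orthogonality of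
characters of `U` it kills the terms outside the orthogonal of `U`. -/
theorem formSum_restrict_orthogonal {χ : AddChar F ℤ} (hχ : χ ≠ 1) (Q : QuadraticForm F V)
    (U : Submodule F V) (hU : ∀ x ∈ U, Q x = 0) :
    formSum χ (Q.restrict (LinearMap.BilinForm.orthogonal Q.polarBilin U)) = formSum χ Q := by
  classical
  have := Fintype.ofFinite F
  have := Fintype.ofFinite V
  set O := LinearMap.BilinForm.orthogonal Q.polarBilin U
  rw [formSum, formSum, finsum_eq_sum_of_fintype, finsum_eq_sum_of_fintype]
  have h1 : ∑ u : U, ∑ x : V, χ (Q (x + u)) = Fintype.card U * ∑ x, χ (Q x) := by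
    rw [Finset.sum_congr rfl (g := fun _ => ∑ x, χ (Q x))]
    · simp
    · intro u _
      exact Fintype.sum_equiv (Equiv.addRight (u : V)) _ _ fun x => rfl
  have h2 : ∀ x : V, ∑ u : U, χ (Q (x + u)) =
      if x ∈ O then Fintype.card U * χ (Q x) else 0 := by
    intro x
    let ψ : AddChar U ℤ := χ.compAddMonoidHom
      ((Q.polarBilin x).comp U.subtype).toAddMonoidHom
    have hψ : ∀ u, ψ u = χ (QuadraticMap.polar Q x u) := fun u => rfl
    have h3 : ∀ u : U, χ (Q (x + u)) = χ (Q x) * ψ u := by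
      intro u
      rw [QuadraticMap.map_add Q, hU u u.2, add_zero, AddChar.map_add_eq_mul, hψ]
    have h4 : ψ = 0 ↔ x ∈ O := by
      constructor
      · intro h u hu
        by_contra hne
        apply hχ
        ext t
        have hb : QuadraticMap.polar Q x u ≠ 0 := by rwa [QuadraticMap.polar_comm]
        -- The multiple of `u` is chosen to have polar value `t` with `x`.
        have h5 := hψ ⟨(t / QuadraticMap.polar Q x u) • u, U.smul_mem _ hu⟩
        rw [h] at h5
        simpa [QuadraticMap.polar_smul_right, hb] using h5.symm
      · intro h
        ext u
        have h6 : QuadraticMap.polar Q u x = 0 := h u u.2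
        rw [hψ, QuadraticMap.polar_comm, h6]
        simp
    rw [Finset.sum_congr rfl fun u _ => h3 u, ← Finset.mul_sum, AddChar.sum_eq_ite]
    simp only [h4]
    split_ifs <;> ring
  rw [Finset.sum_comm, Finset.sum_congr rfl fun x _ => h2 x, ← Finset.sum_filter,
    ← Finset.mul_sum] at h1
  have h7 : (Fintype.card U : ℤ) ≠ 0 := by exact_mod_cast Fintype.card_ne_zero
  rw [← mul_left_cancel₀ h7 h1]
  exact (Finset.sum_subtype _ (by simp) fun x => χ (Q x)).symm

end FormSum

/-! ### The type as the sign of the exponential sum -/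

section Witt

variable {F V : Type*} [Field F] [AddCommGroup V] [Module F V] [FiniteDimensional F V]

theorem bddAbove_finrank_totallySingular (Q : QuadraticForm F V) :
    BddAbove {k : ℕ | ∃ W : Submodule F V, (∀ x ∈ W, Q x = 0) ∧ finrank F W = k} := by
  refine ⟨finrank F V, ?_⟩
  rintro k ⟨W, -, rfl⟩
  exact W.finrank_le

theorem exists_finrank_eq_wittIndex (Q : QuadraticForm F V) :
    ∃ W : Submodule F V, (∀ x ∈ W, Q x = 0) ∧ finrank F W = wittIndex Q :=
  Nat.sSup_mem (s := {k : ℕ | ∃ W : Submodule F V, (∀ x ∈ W, Q x = 0) ∧ finrank F W = k})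
    ⟨0, ⊥, by simp⟩ (bddAbove_finrank_totallySingular Q)

theorem finrank_le_wittIndex {Q : QuadraticForm F V} {W : Submodule F V}
    (hW : ∀ x ∈ W, Q x = 0) : finrank F W ≤ wittIndex Q :=
  le_csSup (bddAbove_finrank_totallySingular Q) ⟨W, hW, rfl⟩

/-- A singular vector orthogonal to a totally singular subspace of largest dimension lies in it. -/
theorem mem_of_finrank_eq_wittIndex {Q : QuadraticForm F V} {W : Submodule F V}
    (hW : ∀ x ∈ W, Q x = 0) (hd : finrank F W = wittIndex Q) {x : V}
    (hx : ∀ w ∈ W, QuadraticMap.polar Q w x = 0) (h0 : Q x = 0) : x ∈ W := by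
  have h1 : ∀ y ∈ W ⊔ Submodule.span F {x}, Q y = 0 := by
    intro y hy
    obtain ⟨w, hw, z, hz, rfl⟩ := Submodule.mem_sup.1 hy
    obtain ⟨c, rfl⟩ := Submodule.mem_span_singleton.1 hz
    rw [QuadraticMap.map_add Q, hW w hw, QuadraticMap.map_smul, h0,
      QuadraticMap.polar_smul_right, hx w hw]
    simp
  have h2 := Submodule.eq_of_le_of_finrank_le (le_sup_left : W ≤ W ⊔ Submodule.span F {x})
    (hd ▸ finrank_le_wittIndex h1)
  rw [h2]
  exact Submodule.mem_sup_right (Submodule.mem_span_singleton_self x)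

variable [Finite F] [CharP F 2]

/-- The exponential sum of a form with non-degenerate polar form in terms of the Witt index. -/
theorem card_sub_one_mul_formSum_eq {χ : AddChar F ℤ} (hχ : χ ≠ 1) {Q : QuadraticForm F V}
    (hQ : Q.polarBilin.SeparatingLeft) :
    ((Nat.card F : ℤ) - 1) * formSum χ Q =
      (Nat.card F : ℤ) ^ (wittIndex Q + 1) - (Nat.card F : ℤ) ^ (finrank F V - wittIndex Q) := by
  have : Finite V := Module.finite_of_finite F
  obtain ⟨U, hU, hd⟩ := exists_finrank_eq_wittIndex Q
  have hnd : LinearMap.BilinForm.Nondegenerate Q.polarBilin :=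
    ((isAlt_polarBilin Q).isRefl.nondegenerate_iff_separatingLeft).2 hQ
  have hO := LinearMap.BilinForm.finrank_orthogonal hnd U
  rw [← formSum_restrict_orthogonal hχ Q U hU, card_sub_one_mul_formSum hχ,
    natCard_eq_pow_finrank (K := F) (V := LinearMap.BilinForm.orthogonal Q.polarBilin U), hO, hd]
  have hUO : ∀ x ∈ U, x ∈ LinearMap.BilinForm.orthogonal Q.polarBilin U := by
    intro x hx w hw
    change QuadraticMap.polar Q w x = 0
    rw [QuadraticMap.polar, hU _ (U.add_mem hw hx), hU _ hw, hU _ hx]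
    simp
  -- By maximality of `U`, the singular vectors orthogonal to `U` are those of `U` itself.
  have e : {x // Q.restrict (LinearMap.BilinForm.orthogonal Q.polarBilin U) x = 0} ≃ U :=
    { toFun := fun x => ⟨x.1.1, mem_of_finrank_eq_wittIndex hU hd x.1.2 x.2⟩
      invFun := fun x => ⟨⟨x.1, hUO x.1 x.2⟩, hU x.1 x.2⟩
      left_inv := fun x => rfl
      right_inv := fun x => rfl }
  rw [Nat.card_congr e, natCard_eq_pow_finrank (K := F) (V := U), hd]
  push_cast
  ring

/-- This makes the Witt index recoverable from the exponential sum. -/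
theorem strictMono_pow_sub_pow {q : ℤ} (hq : 1 < q) (n : ℕ) :
    StrictMono fun w : ℕ => q ^ (w + 1) - q ^ (n - w) := by
  intro a b hab
  have h1 : q ^ (a + 1) < q ^ (b + 1) := pow_lt_pow_right₀ hq (by omega)
  have h2 : q ^ (n - b) ≤ q ^ (n - a) := pow_le_pow_right₀ hq.le (by omega)
  simp only
  linarith

/-- In even dimension the type of a form is the sign of its exponential sum. -/
theorem hasType_iff_formSum {χ : AddChar F ℤ} (hχ : χ ≠ 1) {m : ℕ} (hm : finrank F V = 2 * m)
    {ε : ℤ} (hε : ε = 1 ∨ ε = -1) (Q : QuadraticForm F V) :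
    HasType Q ε ↔
      Q.polarBilin.SeparatingLeft ∧ formSum χ Q = ε * (Nat.card F : ℤ) ^ m := by
  rw [HasType, nondegenerate_iff_separatingLeft Q (by simp [hm])]
  refine and_congr_right fun hQ => ?_
  have hq : (1 : ℤ) < Nat.card F := by exact_mod_cast Finite.one_lt_card
  have hS := card_sub_one_mul_formSum_eq hχ hQ
  rw [hm] at hS ⊢
  generalize (Nat.card F : ℤ) = q at *
  generalize wittIndex Q = w at *
  have hmono := strictMono_pow_sub_pow hq (2 * m)
  have hq1 : q - 1 ≠ 0 := by linarith
  rw [← mul_right_inj' hq1 (b := formSum χ Q), hS]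
  rcases hε with rfl | rfl
  · have h1 : (q - 1) * (1 * q ^ m) = q ^ (m + 1) - q ^ (2 * m - m) := by
      rw [two_mul, Nat.add_sub_cancel]
      ring
    rw [h1, hmono.injective.eq_iff (a := w) (b := m)]
    push_cast
    omega
  · rcases m with _ | m
    · have h2 : 0 ≤ q * (q ^ w - 1) :=
        mul_nonneg (by linarith) (sub_nonneg.2 (one_le_pow₀ hq.le))
      refine iff_of_false (by push_cast; omega) fun h => ?_
      rw [pow_succ] at h
      simp at h
      nlinarith
    · have h1 : (q - 1) * (-1 * q ^ (m + 1)) = q ^ (m + 1) - q ^ (2 * (m + 1) - m) := by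
        rw [show 2 * (m + 1) - m = m + 2 by omega]
        ring
      rw [h1, hmono.injective.eq_iff (a := w) (b := m)]
      push_cast
      omega

end Witt

/-! ### The trace character -/

section TraceChar

variable {F : Type*} [Field F] [Algebra (ZMod 2) F]

/-- The character `t ↦ (-1) ^ Tr t` of a finite field of characteristic two. -/
noncomputable def traceChar (F : Type*) [Field F] [Algebra (ZMod 2) F] : AddChar F ℤ where
  toFun t := if Algebra.trace (ZMod 2) F t = 0 then 1 else -1
  map_zero_eq_one' := by simp
  map_add_eq_mul' s t := by
    rw [map_add]
    generalize Algebra.trace (ZMod 2) F s = a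
    generalize Algebra.trace (ZMod 2) F t = b
    revert a b
    decide

theorem traceChar_apply (t : F) :
    traceChar F t = if Algebra.trace (ZMod 2) F t = 0 then 1 else -1 := rfl

theorem traceChar_eq_neg_one_iff (t : F) :
    traceChar F t = -1 ↔ Algebra.trace (ZMod 2) F t = 1 := by
  rw [traceChar_apply]
  generalize Algebra.trace (ZMod 2) F t = a
  revert a
  decide

variable [Finite F]

theorem traceChar_ne_one : traceChar F ≠ 1 := by
  intro h
  obtain ⟨t, ht⟩ := Algebra.trace_surjective (ZMod 2) F 1
  have h1 := (traceChar_eq_neg_one_iff t).2 ht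
  rw [h] at h1
  norm_num at h1

theorem traceChar_mul_self [CharP F 2] (t : F) : traceChar F (t * t) = traceChar F t := by
  have h := Algebra.trace_eq_of_algEquiv (FiniteField.frobeniusAlgEquiv (ZMod 2) F 2) t
  have h2 : FiniteField.frobeniusAlgEquiv (ZMod 2) F 2 t = t * t := by
    simp [sq]
  rw [traceChar_apply, traceChar_apply, ← h2, h]

end TraceChar

/-! ### Twisted forms and their types -/

section Twist

variable {F W : Type*} [Field F] [AddCommGroup W] [Module F W]

/-- The form `x ↦ Θ x + ⟨a, x⟩ ^ 2`. -/
noncomputable def twist (Θ : QuadraticForm F W) (a : W) : QuadraticForm F W :=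
  Θ + QuadraticMap.sq.comp (Θ.polarBilin a)

theorem twist_apply (Θ : QuadraticForm F W) (a x : W) :
    twist Θ a x = Θ x + QuadraticMap.polar Θ a x * QuadraticMap.polar Θ a x := rfl

variable [CharP F 2]

theorem polar_twist (Θ : QuadraticForm F W) (a x y : W) :
    QuadraticMap.polar (twist Θ a) x y = QuadraticMap.polar Θ x y := by
  have h2 : (2 : F) = 0 := CharTwo.two_eq_zero
  rw [QuadraticMap.polar, twist_apply, twist_apply, twist_apply, QuadraticMap.polar_add_right]
  simp only [QuadraticMap.polar]
  linear_combination ((Θ (a + x) - Θ a - Θ x) * (Θ (a + y) - Θ a - Θ y)) * h2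

theorem twist_apply_add_self (Θ : QuadraticForm F W) (a b : W) :
    twist Θ a (a + b) = Θ (a + b) + QuadraticMap.polar Θ a b ^ 2 := by
  have h : QuadraticMap.polar Θ a a = 0 := isAlt_polarBilin Θ a
  rw [twist_apply, QuadraticMap.polar_add_right, h, zero_add, sq]

theorem formSum_twist [Algebra (ZMod 2) F] [Finite F] (Θ : QuadraticForm F W) (a : W) :
    formSum (traceChar F) (twist Θ a) = traceChar F (Θ a) * formSum (traceChar F) Θ := by
  -- The character does not distinguish `⟨a, x⟩ ^ 2` from `⟨a, x⟩`, and `Θ x + ⟨a, x⟩ = Θ (x + a) +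
  -- Θ a`.
  have h : ∀ x, traceChar F (twist Θ a x) = traceChar F (Θ a) * traceChar F (Θ (x + a)) := by
    intro x
    have h2 : (2 : F) = 0 := CharTwo.two_eq_zero
    rw [twist_apply, AddChar.map_add_eq_mul, traceChar_mul_self, ← AddChar.map_add_eq_mul,
      ← AddChar.map_add_eq_mul, QuadraticMap.map_add Θ x a, QuadraticMap.polar_comm Θ x a]
    congr 1
    linear_combination - Θ a * h2
  rw [formSum, formSum, finsum_congr h, ← mul_finsum]
  exact congrArg _ (finsum_comp_equiv (Equiv.addRight a) (f := fun x => traceChar F (Θ x)))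

/-- Twisting a form by `a` changes its type if and only if `Tr (Θ a) = 1`. -/
theorem hasType_twist_iff [Algebra (ZMod 2) F] [Finite F] [FiniteDimensional F W] {m : ℕ}
    (hm : finrank F W = 2 * m) {ε : ℤ} (hε : ε = 1 ∨ ε = -1) {Θ : QuadraticForm F W}
    (hΘ : HasType Θ (-ε)) (a : W) :
    HasType (twist Θ a) ε ↔ Algebra.trace (ZMod 2) F (Θ a) = 1 := by
  have hχ := traceChar_ne_one (F := F)
  obtain ⟨h1, h2⟩ := (hasType_iff_formSum hχ hm (by omega) Θ).1 hΘ
  have h3 : (twist Θ a).polarBilin.SeparatingLeft := fun x hx =>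
    h1 x fun y => (polar_twist Θ a x y).symm.trans (hx y)
  have hq : ε * (Nat.card F : ℤ) ^ m ≠ 0 :=
    mul_ne_zero (by omega) (pow_ne_zero _ (by exact_mod_cast Nat.card_pos.ne'))
  rw [hasType_iff_formSum hχ hm hε, formSum_twist, h2, ← traceChar_eq_neg_one_iff, and_iff_right h3,
    neg_mul, mul_neg, neg_eq_iff_eq_neg, ← neg_one_mul (ε * _), mul_left_inj' hq]

end Twist

/-! ### Coordinates for a parabolic form -/

section Coordinates

variable {F V W : Type*} [Field F] [CharP F 2] [AddCommGroup V] [Module F V]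
  [AddCommGroup W] [Module F W]

/-- Over a finite field, quadratic forms with the same polar form differ by the square of a linear
form. -/
theorem exists_linearMap_sq [Finite F] (Q Q' : QuadraticForm F W)
    (h : ∀ x y, QuadraticMap.polar Q x y = QuadraticMap.polar Q' x y) :
    ∃ f : W →ₗ[F] F, ∀ x, Q x = Q' x + f x * f x := by
  have hroot : ∀ t : F, ∃ s : F, s ^ 2 = t :=
    (Finite.injective_iff_surjective.1 (CharTwo.sq_injective (R := F)))
  choose r hr using hroot
  have hinj : ∀ s t : F, s ^ 2 = t ^ 2 → s = t := fun s t => CharTwo.sq_inj.1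
  refine ⟨{ toFun := fun x => r (Q x - Q' x), map_add' := fun x y => ?_,
            map_smul' := fun c x => ?_ }, fun x => ?_⟩
  · apply hinj
    rw [CharTwo.add_sq, hr, hr, hr, QuadraticMap.map_add Q, QuadraticMap.map_add Q', h]
    ring
  · apply hinj
    rw [RingHom.id_apply, smul_eq_mul, mul_pow, hr, hr, QuadraticMap.map_smul,
      QuadraticMap.map_smul, smul_eq_mul, smul_eq_mul]
    ring
  · change _ = _ + r _ * r _
    rw [← sq, hr]
    ring

/-- A parabolic form is isometric to the orthogonal sum of any form with non-degenerate polar form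
in one dimension less and of a square. -/
theorem exists_parabolic_coordinates [Finite F] [FiniteDimensional F V] [FiniteDimensional F W]
    (Θ : QuadraticForm F W)
    (hΘ : Θ.polarBilin.SeparatingLeft) (P : QuadraticForm F V) (hP : P.Nondegenerate)
    (hd : finrank F V = finrank F W + 1) :
    ∃ E : (W × F) ≃ₗ[F] V, (∀ x t, P (E (x, t)) = Θ x + t * t) ∧
      nucleus P = Submodule.span F {E (0, 1)} := by
  obtain ⟨K, hK⟩ := Submodule.exists_isCompl (LinearMap.ker P.polarBilin)
  have h1 := even_finrank_sub_ker P hK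
  have h2 := finrank_ker_polarBilin_le hP
  have h3 := Submodule.finrank_add_eq_of_isCompl hK
  have h4 := even_finrank_of_isAlt _ (isAlt_polarBilin Θ) hΘ
  have h5 : finrank F (LinearMap.ker P.polarBilin) = 1 := by
    rcases h1 with ⟨i, hi⟩
    rcases h4 with ⟨j, hj⟩
    omega
  obtain ⟨ψ, hψ⟩ := exists_isometry_of_isAlt _ (isAlt_polarBilin Θ) hΘ _
    (isAlt_polarBilin (P.restrict K)) (separatingLeft_polarBilin_restrict P hK) (by omega)
  obtain ⟨n, hn, hPn, hspan⟩ : ∃ n ∈ LinearMap.ker P.polarBilin, P n = 1 ∧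
      LinearMap.ker P.polarBilin = Submodule.span F {n} := by
    obtain ⟨n, hn, hn0⟩ := Submodule.exists_mem_ne_zero_of_ne_bot
      (fun h => by rw [h] at h5; simp at h5 : LinearMap.ker P.polarBilin ≠ ⊥)
    have hPn : P n ≠ 0 := fun h => hn0 <| by
      have : n ∈ P.radical := ⟨h, hn⟩
      rwa [hP.radical_eq_bot, Submodule.mem_bot] at this
    obtain ⟨s, hs⟩ := Finite.injective_iff_surjective.1 (CharTwo.sq_injective (R := F)) (P n)⁻¹
    have hs0 : s ≠ 0 := by
      rintro rfl
      simp [hPn.symm] at hs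
    have hmem := Submodule.smul_mem _ s hn
    refine ⟨s • n, hmem, ?_, ?_⟩
    · rw [QuadraticMap.map_smul, ← sq]
      simp only at hs
      rw [hs, smul_eq_mul, inv_mul_cancel₀ hPn]
    · refine (Submodule.eq_of_le_of_finrank_eq ?_ ?_).symm
      · rwa [Submodule.span_singleton_le_iff_mem]
      · rw [h5, finrank_span_singleton (smul_ne_zero hs0 hn0)]
  -- `ψ` matches only the polar forms; the forms differ by `f ^ 2`, which `E₀` absorbs by shifting
  -- along the nucleus vector `n`, where `P n = 1`.
  obtain ⟨f, hf⟩ := exists_linearMap_sq Θ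
    ((P.restrict K).comp ψ.toLinearMap) (fun x y => by
      have := hψ x y
      simp only [QuadraticMap.polarBilin_apply_apply, QuadraticMap.polar] at this ⊢
      simp [QuadraticMap.comp_apply, ← this])
  let E₀ : (W × F) →ₗ[F] V :=
    LinearMap.coprod (K.subtype ∘ₗ ψ.toLinearMap + f.smulRight n) (LinearMap.id.smulRight n)
  have hE₀ : ∀ x t, E₀ (x, t) = ψ x + (f x + t) • n := fun x t => by
    simp [E₀]
    module
  have hn0 : n ≠ 0 := by
    rintro rfl
    simp at hPn
  have hinj : Function.Injective E₀ := by
    rw [← LinearMap.ker_eq_bot, LinearMap.ker_eq_bot']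
    rintro ⟨x, t⟩ hx
    rw [hE₀] at hx
    have h6 : (ψ x : V) = 0 := by
      refine Submodule.disjoint_def.1 hK.disjoint _ ?_ (ψ x).2
      rw [eq_neg_of_add_eq_zero_left hx]
      exact Submodule.neg_mem _ (Submodule.smul_mem _ _ hn)
    have h7 : x = 0 := by simpa using h6
    subst h7
    simpa [hn0] using hx
  refine ⟨LinearEquiv.ofInjectiveOfFinrankEq E₀ hinj (by simp [hd]), fun x t => ?_, ?_⟩
  · have h8 : QuadraticMap.polar P (ψ x) ((f x + t) • n) = 0 := by
      rw [QuadraticMap.polar_comm]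
      exact DFunLike.congr_fun (LinearMap.mem_ker.1 (Submodule.smul_mem _ (f x + t) hn)) (ψ x : V)
    have h9 : Θ x = P (ψ x) + f x * f x := hf x
    have h10 : (2 : F) = 0 := CharTwo.two_eq_zero
    change P (E₀ (x, t)) = _
    rw [hE₀, QuadraticMap.map_add P, h8, QuadraticMap.map_smul, hPn, h9, smul_eq_mul]
    linear_combination (f x * t) * h10
  · change _ = Submodule.span F {E₀ (0, 1)}
    rw [nucleus, hspan, hE₀]
    simp

end Coordinates

/-! ### Hyperplanes missing the nucleus, and adjacency -/

section Graph

variable {F V W : Type*} [Field F] [AddCommGroup V] [Module F V] [AddCommGroup W] [Module F W]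

/-- The hyperplane of the points `(x, ⟨a, x⟩)` in the coordinates `E`. -/
noncomputable def twistHyperplane (Θ : QuadraticForm F W) (E : (W × F) ≃ₗ[F] V) (a : W) :
    Submodule F V :=
  LinearMap.range (E.toLinearMap ∘ₗ LinearMap.prod LinearMap.id (Θ.polarBilin a))

variable (Θ : QuadraticForm F W) (E : (W × F) ≃ₗ[F] V)

theorem mem_twistHyperplane {a x : W} {t : F} :
    E (x, t) ∈ twistHyperplane Θ E a ↔ t = QuadraticMap.polar Θ a x := by
  constructor
  · rintro ⟨y, hy⟩
    obtain ⟨rfl, rfl⟩ := Prod.mk.inj (E.injective hy)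
    rfl
  · rintro rfl
    exact ⟨x, rfl⟩

theorem exists_eq_of_mem_twistHyperplane {a : W} {v : V} (hv : v ∈ twistHyperplane Θ E a) :
    ∃ x, v = E (x, QuadraticMap.polar Θ a x) := by
  obtain ⟨x, rfl⟩ := hv
  exact ⟨x, rfl⟩

/-- The parametrization of the hyperplane attached to `a`. -/
noncomputable def twistHyperplaneEquiv (a : W) : W ≃ₗ[F] twistHyperplane Θ E a :=
  LinearEquiv.ofInjective _ fun _ _ h => congrArg Prod.fst (E.injective h)

variable {Θ E}

theorem twistHyperplane_injective (hΘ : Θ.polarBilin.SeparatingLeft) :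
    Function.Injective (twistHyperplane Θ E) := by
  intro a b h
  rw [← sub_eq_zero]
  refine hΘ _ fun x => ?_
  have h1 : E (x, QuadraticMap.polar Θ a x) ∈ twistHyperplane Θ E b :=
    h ▸ (mem_twistHyperplane Θ E).2 rfl
  rw [mem_twistHyperplane] at h1
  rw [map_sub, LinearMap.sub_apply, sub_eq_zero]
  exact h1

theorem isCoatom_twistHyperplane (a : W) : IsCoatom (twistHyperplane Θ E a) := by
  let f : V →ₗ[F] F :=
    (LinearMap.snd F W F - Θ.polarBilin a ∘ₗ LinearMap.fst F W F) ∘ₗ E.symm.toLinearMap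
  have hf : ∀ x t, f (E (x, t)) = t - QuadraticMap.polar Θ a x := fun x t => by simp [f]
  have h : twistHyperplane Θ E a = LinearMap.ker f := by
    ext v
    obtain ⟨⟨x, t⟩, rfl⟩ := E.surjective v
    rw [mem_twistHyperplane, LinearMap.mem_ker, hf, sub_eq_zero]
  rw [h]
  exact LinearMap.isCoatom_ker_of_surjective fun t => ⟨E (0, t), by simp [hf]⟩

theorem exists_eq_twistHyperplane [FiniteDimensional F W] (hΘ : Θ.polarBilin.SeparatingLeft)
    {H : Submodule F V} (hH : IsCoatom H) (hE : E (0, 1) ∉ H) :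
    ∃ a, H = twistHyperplane Θ E a := by
  obtain ⟨f, hf1, hf⟩ : ∃ f : V →ₗ[F] F, f (E (0, 1)) ≠ 0 ∧ H ≤ LinearMap.ker f := by
    obtain ⟨f, h1, h2⟩ := Submodule.exists_le_ker_of_notMem hE
    exact ⟨f, h1, h2⟩
  set s := f (E (0, 1)) with hs
  -- Solving `f (E (x, t)) = 0` for `t` gives `t = g x`; non-degeneracy then represents `g` as `⟨a,
  -- ·⟩`.
  let g : W →ₗ[F] F := -s⁻¹ • (f ∘ₗ E.toLinearMap ∘ₗ LinearMap.inl F W F)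
  have hinj : Function.Injective Θ.polarBilin :=
    LinearMap.ker_eq_bot.1 (LinearMap.separatingLeft_iff_ker_eq_bot.1 hΘ)
  obtain ⟨a, ha⟩ := (LinearMap.injective_iff_surjective_of_finrank_eq_finrank
    (Subspace.dual_finrank_eq (K := F) (V := W)).symm).1 hinj g
  refine ⟨a, ((hH.le_iff_eq (isCoatom_twistHyperplane a).1).1 fun v hv => ?_).symm⟩
  obtain ⟨⟨x, t⟩, rfl⟩ := E.surjective v
  have hx : (x, t) = (x, (0 : F)) + t • ((0 : W), (1 : F)) := by simp
  have h1 := hf hv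
  rw [LinearMap.mem_ker, hx, map_add, map_smul, map_add, map_smul, ← hs, smul_eq_mul] at h1
  rw [mem_twistHyperplane]
  have h2 : QuadraticMap.polar Θ a x = -s⁻¹ * f (E (x, 0)) := DFunLike.congr_fun ha x
  rw [h2, eq_neg_of_add_eq_zero_left h1]
  field_simp

variable {P : QuadraticForm F V}

/-- The restriction of the parabolic form to the hyperplane attached to `a` is a twist. -/
theorem restrict_twistHyperplaneEquiv (hP : ∀ x t, P (E (x, t)) = Θ x + t * t) (a x : W) :
    P.restrict (twistHyperplane Θ E a) (twistHyperplaneEquiv Θ E a x) = twist Θ a x :=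
  hP _ _

theorem polar_twistHyperplane [CharP F 2] (hP : ∀ x t, P (E (x, t)) = Θ x + t * t) (a x y : W) :
    QuadraticMap.polar P (E (x, QuadraticMap.polar Θ a x)) (E (y, QuadraticMap.polar Θ a y)) =
      QuadraticMap.polar Θ x y := by
  refine Eq.trans ?_ (polar_twist Θ a x y)
  change P (_ + _) - P _ - P _ = twist Θ a (x + y) - twist Θ a x - twist Θ a y
  rw [← map_add, Prod.mk_add_mk, ← QuadraticMap.polar_add_right, hP, hP, hP]
  rfl

theorem hasType_restrict_twistHyperplane_iff [Finite F] [CharP F 2] [Algebra (ZMod 2) F]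
    [FiniteDimensional F V] [FiniteDimensional F W]
    (hP : ∀ x t, P (E (x, t)) = Θ x + t * t) {m : ℕ} (hm : finrank F W = 2 * m)
    {ε : ℤ} (hε : ε = 1 ∨ ε = -1) (hΘ : HasType Θ (-ε)) (a : W) :
    HasType (P.restrict (twistHyperplane Θ E a)) ε ↔ Algebra.trace (ZMod 2) F (Θ a) = 1 := by
  have hχ := traceChar_ne_one (F := F)
  rw [← hasType_twist_iff hm hε hΘ a, hasType_iff_formSum hχ hm hε,
    hasType_iff_formSum hχ ((twistHyperplaneEquiv Θ E a).finrank_eq.symm.trans hm) hε,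
    formSum_congr (traceChar F) (twistHyperplaneEquiv Θ E a).toEquiv
      (restrict_twistHyperplaneEquiv hP a)]
  have hs := ((hasType_iff_formSum hχ hm (by omega) Θ).1 hΘ).1
  -- Both polar forms are that of `Θ`, so non-degeneracy holds on each side.
  refine and_congr_left fun _ => iff_of_true (fun v hv => ?_) fun x hx =>
    hs x fun y => (polar_twist Θ a x y).symm.trans (hx y)
  obtain ⟨x, rfl⟩ := (twistHyperplaneEquiv Θ E a).surjective v
  rw [hs x fun y => ?_, map_zero]
  rw [QuadraticMap.polarBilin_apply_apply, ← polar_twistHyperplane hP a x y]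
  exact hv (twistHyperplaneEquiv Θ E a y)

/-- The intersection of the hyperplanes attached to `a ≠ b` meets the quadric in a degenerate
quadric if and only if the twist of the form by `a` vanishes at `a + b`. -/
theorem nondegenerate_restrict_inf_iff [CharP F 2] [FiniteDimensional F W]
    (hP : ∀ x t, P (E (x, t)) = Θ x + t * t) (hΘ : Θ.polarBilin.SeparatingLeft) {a b : W}
    (hab : a ≠ b) :
    (P.restrict (twistHyperplane Θ E a ⊓ twistHyperplane Θ E b)).Nondegenerate ↔
      twist Θ a (a + b) ≠ 0 := by
  set c := a + b with hc
  set K := twistHyperplane Θ E a ⊓ twistHyperplane Θ E b with hK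
  have hc0 : c ≠ 0 := fun h => hab <| by
    have h1 : (2 : F) = 0 := CharTwo.two_eq_zero
    have h2 : b + b = 0 := by rw [← two_smul F, h1, zero_smul]
    exact add_right_cancel ((hc.symm.trans h).trans h2.symm)
  have hmem : ∀ x, E (x, QuadraticMap.polar Θ a x) ∈ K ↔ QuadraticMap.polar Θ c x = 0 := by
    intro x
    rw [hK, Submodule.mem_inf, mem_twistHyperplane, mem_twistHyperplane, hc,
      QuadraticMap.polar_add_left, CharTwo.add_eq_zero]
    simp
  have hcc : QuadraticMap.polar Θ c c = 0 := isAlt_polarBilin Θ c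
  let k : K := ⟨E (c, QuadraticMap.polar Θ a c), (hmem c).2 hcc⟩
  have hk0 : k ≠ 0 := fun h => hc0 <| by
    have h1 : E (c, QuadraticMap.polar Θ a c) = 0 := congrArg Subtype.val h
    rw [map_eq_zero_iff E E.injective] at h1
    exact congrArg Prod.fst h1
  have hPk : P.restrict K k = twist Θ a c := hP _ _
  have hpar : ∀ v : K, ∃ x, QuadraticMap.polar Θ c x = 0 ∧
      (v : V) = E (x, QuadraticMap.polar Θ a x) := by
    intro v
    obtain ⟨x, hx⟩ := exists_eq_of_mem_twistHyperplane Θ E v.2.1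
    exact ⟨x, (hmem x).1 (hx ▸ v.2), hx⟩
  have hk : k ∈ LinearMap.ker (P.restrict K).polarBilin := by
    rw [LinearMap.mem_ker]
    ext v
    obtain ⟨x, hx, hv⟩ := hpar v
    change QuadraticMap.polar P k v = 0
    rw [hv, polar_twistHyperplane hP, hx]
  have hker : ∀ v ∈ LinearMap.ker (P.restrict K).polarBilin, ∃ r : F, r • k = v := by
    intro v hv
    obtain ⟨x, hx, hvx⟩ := hpar v
    -- A radical vector over `x` makes `⟨x, ·⟩` vanish on `c^⊥`, so `⟨x, ·⟩` is a multiple of `⟨c,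
    -- ·⟩`, and `x` of `c`.
    have h1 : LinearMap.ker (Θ.polarBilin c) ≤ LinearMap.ker (Θ.polarBilin x) := by
      intro y hy
      have h2 : QuadraticMap.polar P v (E (y, QuadraticMap.polar Θ a y)) = 0 :=
        DFunLike.congr_fun (LinearMap.mem_ker.1 hv) ⟨_, (hmem y).2 hy⟩
      rwa [hvx, polar_twistHyperplane hP] at h2
    have h3 : Θ.polarBilin x ∈ Submodule.span F (Set.range fun _ : Unit => Θ.polarBilin c) :=
      mem_span_of_iInf_ker_le_ker (by simpa using h1)
    rw [Set.range_const, Submodule.mem_span_singleton] at h3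
    obtain ⟨r, hr⟩ := h3
    have h4 : r • c = x := LinearMap.ker_eq_bot.1
      (LinearMap.separatingLeft_iff_ker_eq_bot.1 hΘ) (by rw [map_smul, hr])
    refine ⟨r, Subtype.ext ?_⟩
    rw [hvx, ← h4, QuadraticMap.polar_smul_right]
    exact (map_smul E r _).symm
  constructor
  · intro h h0
    have h1 : k ∈ (P.restrict K).radical := ⟨hPk.trans h0, hk⟩
    rw [h.radical_eq_bot] at h1
    exact hk0 h1
  · intro h
    refine ⟨?_, ?_⟩
    · rw [eq_bot_iff]
      rintro v ⟨hv0, hv⟩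
      obtain ⟨r, rfl⟩ := hker v hv
      rw [QuadraticMap.map_smul, hPk, smul_eq_mul] at hv0
      have : r = 0 := by simpa [h] using hv0
      simp [this]
    · rw [rank_le_one_iff]
      refine ⟨⟨k, hk⟩, fun v => ?_⟩
      obtain ⟨r, hr⟩ := hker v v.2
      exact ⟨r, Subtype.ext hr⟩

end Graph

end PolarGraph

theorem mainTheorem5 {F : Type*} [Field F] [Finite F] [CharP F 2] [Algebra (ZMod 2) F]
    (m : ℕ) (ε : ℤ) (hε : ε = 1 ∨ ε = -1)
    (Θ : QuadraticForm F (Fin (2 * m) → F)) (hΘ : PolarGraph.HasType Θ (-ε))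
    (P : QuadraticForm F (Fin (2 * m + 1) → F)) (hP : PolarGraph.HasType P 0) :
    Nonempty (PolarGraph.analyticGraph Θ ≃g PolarGraph.graphNO P ε) := by
  have hm : Module.finrank F (Fin (2 * m) → F) = 2 * m := by simp
  have hs := (PolarGraph.nondegenerate_iff_separatingLeft Θ (by simp)).1 hΘ.1
  obtain ⟨E, hE, hn⟩ := PolarGraph.exists_parabolic_coordinates Θ hs P hP.1 (by simp)
  have hmem : ∀ H : Submodule F (Fin (2 * m + 1) → F),
      PolarGraph.nucleus P ≤ H ↔ E (0, 1) ∈ H := fun H => by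
    rw [hn, Submodule.span_singleton_le_iff_mem]
  have htype := PolarGraph.hasType_restrict_twistHyperplane_iff (P := P) hE hm hε hΘ
  have hvert : ∀ a, Algebra.trace (ZMod 2) F (Θ a) = 1 →
      PolarGraph.IsVertexNO P ε (PolarGraph.twistHyperplane Θ E a) := fun a ha => by
    refine ⟨PolarGraph.isCoatom_twistHyperplane a, ?_, (htype a).2 ha⟩
    rw [hmem, PolarGraph.mem_twistHyperplane]
    simp
  refine ⟨⟨Equiv.ofBijective (fun a => ⟨_, hvert a.1 a.2⟩) ⟨fun a b h => ?_, fun H => ?_⟩, ?_⟩⟩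
  · exact Subtype.ext (PolarGraph.twistHyperplane_injective hs (congrArg Subtype.val h))
  · obtain ⟨H, h1, h2, h3⟩ := H
    obtain ⟨a, rfl⟩ := PolarGraph.exists_eq_twistHyperplane hs h1 (mt (hmem H).2 h2)
    exact ⟨⟨a, (htype a).1 h3⟩, rfl⟩
  · intro a b
    change _ ≠ _ ∧ ¬ (P.restrict (PolarGraph.twistHyperplane Θ E a ⊓
      PolarGraph.twistHyperplane Θ E b)).Nondegenerate ↔ a ≠ b ∧ _
    rw [ne_eq, Equiv.apply_eq_iff_eq]
    refine and_congr_right fun hab => ?_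
    rw [PolarGraph.nondegenerate_restrict_inf_iff hE hs (Subtype.coe_ne_coe.2 hab), not_not,
      PolarGraph.twist_apply_add_self, CharTwo.add_eq_zero]
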